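/- **Theorem (depth reduction to depth four; Agrawal–Vinay, Koiran, Tavenas).** An arithmetic circuit over a field $\mathbb F$ is a finite directed acyclic graph whose gates are inputs (variables or constants of $\mathbb F$), sum gates of arbitrary fan-in (wires into sum gates may carry constants of $\mathbb F$, so that a sum gate computes a linear combination of its children) and product gates of arbitrary fan-in, with a designated output gate. Its size is the number of its gates plus the number of its wires. It is *homogeneous* if its gates can be assigned degrees so that variables have degree $1$, constants have degree $0$, all children of a sum gate have the degree of that gate, and the degree of a product gate is the sum of the degrees of its children; in particular every gate then computes a homogeneous polynomial. A $\Sigma\Pi\Sigma\Pi^{[t]}$ circuit is a circuit whose output is a sum of products of sums of products of inputs, in which every product gate of the bottom level has fan-in at most $t$. The top fan-in is the fan-in of the output gate. For every $k\in\mathbb N$ there is a constant $c$ such that the following holds for every field $\mathbb F$ and all natural numbers $n, d, s, t$ with $s\ge 2$, $d\le s^k$ and $0<t\le d$. Let $f\in\mathbb F[x_1,\dots,x_n]$ be a polynomial of degree $d$ that is computed by an arithmetic circuit of size at most $s$. Then $f$ is computed by a $\Sigma\Pi\Sigma\Pi^{[t]}$ circuit of top fan-in at most $s^{c\,d/t}$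 and size at most $s^{c\,(t+d/t)}$. If $f$ is homogeneous, then this circuit is homogeneous; if $f$ is not homogeneous (so that no homogeneous circuit can compute it), the condition of homogeneity holds at every gate except the output gate, so that the output is a sum of homogeneously computed polynomials of possibly different degrees. -/

import Mathlib

universe u v

/-- The label of a gate of an arithmetic circuit over `F` with input variables `σ` and set of
gates `V`: an input gate (a variable or a field constant), a sum gate whose incoming wires carry
field constants, so that it computes a linear combination of its children, or a product gate.
Fan-in is unbounded, and parallel wires are allowed (for instance in a squaring). -/
inductive Gate (F : Type u) (σ : Type v) (V : Type) where
  | var (i : σ) : Gate F σ V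
  | const (a : F) : Gate F σ V
  | add (l : List (F × V)) : Gate F σ V
  | mul (l : List V) : Gate F σ V

/-- The gates from which the incoming wires start, with multiplicity. -/
def Gate.children {F : Type u} {σ : Type v} {V : Type} : Gate F σ V → List V
  | .var _ => []
  | .const _ => []
  | .add l => l.map Prod.snd
  | .mul l => l

/-- An arithmetic circuit: a finite directed acyclic graph of gates with a chosen output gate. -/
structure Circuit (F : Type u) (σ : Type v) where
  V : Type
  fintypeV : Fintype V
  gate : V → Gate F σ V
  acyclic : WellFounded (fun a b : V => a ∈ (gate b).children)
  out : V

namespace Circuit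

attribute [instance] Circuit.fintypeV

/-- The polynomial computed by a gate, given the polynomials computed by its children. -/
noncomputable def step {F : Type u} [Field F] {σ : Type v} {V : Type} (g : Gate F σ V)
    (val : ∀ a : V, a ∈ g.children → MvPolynomial σ F) : MvPolynomial σ F :=
  match g, val with
  | .var i, _ => MvPolynomial.X i
  | .const a, _ => MvPolynomial.C a
  | .add l, val => (l.attach.map fun p =>
      MvPolynomial.C p.1.1 * val p.1.2 (List.mem_map_of_mem p.2)).sum
  | .mul l, val => (l.attach.map fun a => val a.1 a.2).prod

/-- The polynomial computed at a gate of the circuit. -/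
noncomputable def eval {F : Type u} [Field F] {σ : Type v} (C : Circuit F σ) :
    C.V → MvPolynomial σ F :=
  C.acyclic.fix fun b val => step (C.gate b) val

/-- The recursion satisfied by the polynomials computed at the gates. -/
theorem eval_eq {F : Type u} [Field F] {σ : Type v} (C : Circuit F σ) (b : C.V) :
    C.eval b = match C.gate b with
      | .var i => MvPolynomial.X i
      | .const a => MvPolynomial.C a
      | .add l => (l.map fun p => MvPolynomial.C p.1 * C.eval p.2).sum
      | .mul l => (l.map C.eval).prod := by
  have h : C.eval b = step (C.gate b) (fun a _ => C.eval a) := C.acyclic.fix_eq _ b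
  rw [h]
  cases C.gate b with
  | var i => rfl
  | const a => rfl
  | add l =>
    simp only [step]
    exact congrArg List.sum (List.attach_map_val (l := l)
      (f := fun p => MvPolynomial.C p.1 * C.eval p.2))
  | mul l =>
    simp only [step]
    exact congrArg List.prod (List.attach_map_val (l := l) (f := C.eval))

/-- The circuit computes `f` (at its output gate). -/
def Computes {F : Type u} [Field F] {σ : Type v} (C : Circuit F σ) (f : MvPolynomial σ F) : Prop :=
  C.eval C.out = f

/-- The fan-in of a gate: the number of its incoming wires. -/
def fanIn {F : Type u} {σ : Type v} (C : Circuit F σ) (a : C.V) : ℕ :=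
  (C.gate a).children.length

/-- The top fan-in: the fan-in of the output gate. -/
def topFanIn {F : Type u} {σ : Type v} (C : Circuit F σ) : ℕ :=
  C.fanIn C.out

/-- The size: the number of gates (input gates included) plus the number of wires. -/
def size {F : Type u} {σ : Type v} (C : Circuit F σ) : ℕ :=
  Fintype.card C.V + ∑ a : C.V, C.fanIn a

/-- An input gate. -/
def IsInput {F : Type u} {σ : Type v} (C : Circuit F σ) (a : C.V) : Prop :=
  (∃ i, C.gate a = .var i) ∨ (∃ x, C.gate a = .const x)

/-- A product gate of fan-in at most `b` that is fed by input gates. -/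
def IsPi {F : Type u} {σ : Type v} (C : Circuit F σ) (b : ℕ) (a : C.V) : Prop :=
  ∃ l, C.gate a = .mul l ∧ l.length ≤ b ∧ ∀ x ∈ l, C.IsInput x

/-- A sum gate fed by such product gates. -/
def IsSigmaPi {F : Type u} {σ : Type v} (C : Circuit F σ) (b : ℕ) (a : C.V) : Prop :=
  ∃ l, C.gate a = .add l ∧ ∀ p ∈ l, C.IsPi b p.2

/-- A product gate fed by such sum gates. -/
def IsPiSigmaPi {F : Type u} {σ : Type v} (C : Circuit F σ) (b : ℕ) (a : C.V) : Prop :=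
  ∃ l, C.gate a = .mul l ∧ ∀ x ∈ l, C.IsSigmaPi b x

/-- `ΣΠΣΠ^[b]` circuits: the output is a sum of products of sums of products of inputs, and the
product gates at the bottom level have fan-in at most `b`. -/
def IsSigmaPiSigmaPi {F : Type u} {σ : Type v} (C : Circuit F σ) (b : ℕ) : Prop :=
  ∃ l, C.gate C.out = .add l ∧ ∀ p ∈ l, C.IsPiSigmaPi b p.2

/-- The degree assignment `deg` is respected at the gate `a`: variables have degree `1`, constants
degree `0`, the children of a sum gate have the degree of the gate, and the degree of a product
gate is the sum of the degrees of its children. -/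
def RespectsDegree {F : Type u} {σ : Type v} (C : Circuit F σ) (deg : C.V → ℕ) (a : C.V) : Prop :=
  match C.gate a with
  | .var _ => deg a = 1
  | .const _ => deg a = 0
  | .add l => ∀ p ∈ l, deg p.2 = deg a
  | .mul l => deg a = (l.map deg).sum

/-- Homogeneous circuits, in the strict sense: there is a degree assignment respected at every
gate. In particular every gate computes a homogeneous polynomial (`IsHomogeneous.eval`). -/
def IsHomogeneous {F : Type u} {σ : Type v} (C : Circuit F σ) : Prop :=
  ∃ deg : C.V → ℕ, ∀ a, C.RespectsDegree deg a

/-- Circuits that are homogeneous except possibly at the output gate, so that the output is a sum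
of polynomials, of possibly different degrees, each computed homogeneously. -/
def IsHomogeneousBelowOutput {F : Type u} {σ : Type v} (C : Circuit F σ) : Prop :=
  ∃ deg : C.V → ℕ, ∀ a, a ≠ C.out → C.RespectsDegree deg a

theorem IsHomogeneous.eval {F : Type u} [Field F] {σ : Type v} {C : Circuit F σ}
    (h : C.IsHomogeneous) (a : C.V) : ∃ e, (C.eval a).IsHomogeneous e := by
  obtain ⟨deg, hdeg⟩ := h
  refine ⟨deg a, ?_⟩
  induction a using C.acyclic.induction with
  | _ a ih =>
    have h1 := hdeg a
    rw [eval_eq]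
    unfold RespectsDegree at h1
    cases hg : C.gate a with
    | var i => simp only [hg] at h1 ⊢; rw [h1]; exact MvPolynomial.isHomogeneous_X F i
    | const x => simp only [hg] at h1 ⊢; rw [h1]; exact MvPolynomial.isHomogeneous_C σ x
    | add l =>
      simp only [hg, Gate.children] at h1 ih ⊢
      rw [← MvPolynomial.mem_homogeneousSubmodule]
      refine list_sum_mem fun q hq => ?_
      obtain ⟨p, hp, rfl⟩ := List.mem_map.1 hq
      rw [MvPolynomial.mem_homogeneousSubmodule, ← h1 p hp]
      exact (ih p.2 (List.mem_map_of_mem hp)).C_mul _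
    | mul l =>
      simp only [hg, Gate.children] at h1 ih ⊢
      rw [h1]
      clear h1 hg
      induction l with
      | nil => simpa using MvPolynomial.isHomogeneous_one σ F
      | cons x l ihl =>
        simp only [List.map_cons, List.prod_cons, List.sum_cons]
        exact (ih x (by simp)).mul (ihl fun y hy => ih y (by simp [hy]))

end Circuit

/-! Replace each product gate by its successive prefix products and split all values into
homogeneous components up to degree `d`. This gives a set `G` of polynomially many (in `s`)
polynomials `f u` of degree `d u`. Each of degree at least two is a linear combination of products
`f y * f x`, where `x` is the factor of larger degree and precedes `u` in a well-founded order
(`component_mem_span`). Reading the lighter factor `f y` as the weight of an edge from `u` to `x`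
makes the system linear. Let `Q u w` be the total weight of the paths from `u` to `w`; it is
homogeneous of degree `d u - d w`. Degrees do not increase along a path, so cutting every path where
it first falls to half the degree of `u` writes `f u` as a sum over triples `(w, x, y)` of multiples
of `Q u w * f x * f y`, with all three degrees at most half (`eq_sum_frontier`). The polynomials `Q
u v` decompose in the same way, except that the edge weight `f y` may stay heavy. Now expand factors
until all degrees are at most `t`. A potential argument (`expansionBound_step_path`,
`expansionBound_step_gate`) shows that `O(d/t)` expansions suffice. Each one multiplies the number
of summands by `|G|^3` and adds two factors, so there are `s^{O(d/t)}` products of `O(d/t)` factors.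
A factor of degree at most `t` is a combination of at most `s^t` words in the variables of the
circuit, and this is the depth four circuit. -/

/-! ### Calculus of short sums of products of low-degree factors. -/

section BoundedProducts

variable {F R : Type*} [CommRing F] [CommRing R] [Algebra F R]

/-- Products of `K` factors, each taken from a power of `S` with exponent at most `t`, the
exponents adding up to `e`. -/
def IsBoundedProd (S : Submodule F R) (t K e : ℕ) (p : R) : Prop :=
  ∃ (g : Fin K → R) (δ : Fin K → ℕ),
    (∀ j, δ j ≤ t ∧ g j ∈ S ^ δ j) ∧ ∑ j, δ j = e ∧ p = ∏ j, g j

/-- Linear combinations of at most `A` such products. -/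
def IsSumBoundedProd (S : Submodule F R) (t A K e : ℕ) (p : R) : Prop :=
  ∃ L : List (F × R), L.length ≤ A ∧ (∀ q ∈ L, IsBoundedProd S t K e q.2) ∧
    p = (L.map fun q => q.1 • q.2).sum

variable {S : Submodule F R} {t : ℕ}

theorem IsBoundedProd.mul {K K' e e' : ℕ} {p p' : R} (h : IsBoundedProd S t K e p)
    (h' : IsBoundedProd S t K' e' p') : IsBoundedProd S t (K + K') (e + e') (p * p') := by
  obtain ⟨g, δ, h1, h2, rfl⟩ := h
  obtain ⟨g', δ', h1', h2', rfl⟩ := h'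
  refine ⟨Fin.append g g', Fin.append δ δ', fun j => ?_, ?_, ?_⟩
  · induction j using Fin.addCases with
    | left i => simpa using h1 i
    | right i => simpa using h1' i
  · simp [Fin.sum_univ_add, h2, h2']
  · simp [Fin.prod_univ_add]

theorem isBoundedProd_one (K : ℕ) : IsBoundedProd S t K 0 1 :=
  ⟨fun _ => 1, fun _ => 0, fun _ => ⟨by simp, by
    simpa using (Submodule.one_le (P := (1 : Submodule F R))).1 le_rfl⟩, by simp, by simp⟩

/-- Padding by factors `1` of exponent `0` lets all products have exactly the same number of
factors. -/
theorem IsBoundedProd.mono {K K' e : ℕ} {p : R} (h : IsBoundedProd S t K e p) (hK : K ≤ K') :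
    IsBoundedProd S t K' e p := by
  obtain ⟨i, rfl⟩ := Nat.exists_eq_add_of_le hK
  simpa using h.mul (isBoundedProd_one i)

namespace IsSumBoundedProd

theorem mono {A A' K K' e : ℕ} {p : R} (h : IsSumBoundedProd S t A K e p) (hA : A ≤ A')
    (hK : K ≤ K') : IsSumBoundedProd S t A' K' e p := by
  obtain ⟨L, h1, h2, h3⟩ := h
  exact ⟨L, h1.trans hA, fun q hq => (h2 q hq).mono hK, h3⟩

theorem zero (A K e : ℕ) : IsSumBoundedProd S t A K e (0 : R) :=
  ⟨[], by simp, by simp, by simp⟩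

theorem of_mem {e : ℕ} {p : R} (he : e ≤ t) (hp : p ∈ S ^ e) : IsSumBoundedProd S t 1 1 e p :=
  ⟨[(1, p)], by simp, by
    simpa using ⟨fun _ => p, fun _ => e, fun _ => ⟨he, hp⟩, by simp, by simp⟩, by simp⟩

theorem add {A A' K e : ℕ} {p p' : R} (h : IsSumBoundedProd S t A K e p)
    (h' : IsSumBoundedProd S t A' K e p') : IsSumBoundedProd S t (A + A') K e (p + p') := by
  obtain ⟨L, h1, h2, rfl⟩ := h
  obtain ⟨L', h1', h2', rfl⟩ := h'
  refine ⟨L ++ L', by simp; omega, fun q hq => ?_, by simp⟩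
  exact (List.mem_append.1 hq).elim (h2 q) (h2' q)

theorem finset_sum {ι : Type*} (s : Finset ι) {A K e : ℕ} {p : ι → R}
    (h : ∀ i ∈ s, IsSumBoundedProd S t A K e (p i)) :
    IsSumBoundedProd S t (s.card * A) K e (∑ i ∈ s, p i) := by
  classical
  induction s using Finset.induction_on with
  | empty => simpa using zero _ _ _
  | insert a s ha ih =>
    rw [Finset.sum_insert ha, Finset.card_insert_of_notMem ha]
    exact ((h a (by simp)).add (ih fun i hi => h i (by simp [hi]))).mono (by ring_nf; rfl) le_rfl

theorem smul {A K e : ℕ} {p : R} (c : F) (h : IsSumBoundedProd S t A K e p) :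
    IsSumBoundedProd S t A K e (c • p) := by
  obtain ⟨L, h1, h2, rfl⟩ := h
  refine ⟨L.map fun q => (c * q.1, q.2), by simpa using h1, fun q hq => ?_, ?_⟩
  · obtain ⟨q', hq', rfl⟩ := List.mem_map.1 hq
    exact h2 q' hq'
  · simp [List.smul_sum, Function.comp_def, mul_smul]

theorem mul {A A' K K' e e' : ℕ} {p p' : R} (h : IsSumBoundedProd S t A K e p)
    (h' : IsSumBoundedProd S t A' K' e' p') :
    IsSumBoundedProd S t (A * A') (K + K') (e + e') (p * p') := by
  obtain ⟨L, h1, h2, rfl⟩ := h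
  obtain ⟨L', h1', h2', rfl⟩ := h'
  refine ⟨(L ×ˢ L').map fun z => (z.1.1 * z.2.1, z.1.2 * z.2.2), ?_, fun q hq => ?_, ?_⟩
  · simpa [List.length_product] using Nat.mul_le_mul h1 h1'
  · obtain ⟨z, hz, rfl⟩ := List.mem_map.1 hq
    obtain ⟨z₁, z₂⟩ := z
    have hz' := List.pair_mem_product.1 hz
    exact (h2 _ hz'.1).mul (h2' _ hz'.2)
  · clear h1 h2 h1' h2'
    induction L with
    | nil => simp
    | cons a L ih =>
      rw [List.product_cons, List.map_append, List.map_append, List.sum_append, ← ih, List.map_cons, List.sum_cons,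
        add_mul]
      congr 1
      simp only [List.map_map, Function.comp_def, smul_mul_smul_comm, ← List.sum_map_mul_left]

/-- One term of an expansion, where `N` counts expansions. The exponent `N - 1` leaves one factor
`M` to pay for the sum over all triples; three products of `2 * Nᵢ + 1` factors fit into `2 * N +
1`. -/
theorem smul_mul_mul {M N N₁ N₂ N₃ a b e : ℕ} {p q r : R} (k : F) (hM : 1 ≤ M)
    (hp : IsSumBoundedProd S t (M ^ N₁) (2 * N₁ + 1) a p)
    (hq : IsSumBoundedProd S t (M ^ N₂) (2 * N₂ + 1) b q)
    (hr : IsSumBoundedProd S t (M ^ N₃) (2 * N₃ + 1) e r) (hN : N₁ + N₂ + N₃ + 1 ≤ N) :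
    IsSumBoundedProd S t (M ^ (N - 1)) (2 * N + 1) (a + b + e) (k • (p * q * r)) := by
  refine (((hp.mul hq).mul hr).smul k).mono ?_ (by omega)
  rw [← pow_add, ← pow_add]
  exact Nat.pow_le_pow_right hM (by omega)

end IsSumBoundedProd

end BoundedProducts

/-! ### Path polynomials and the cut at a degree threshold. -/

section Frontier

/-- The path polynomials of a linear system along a well-founded relation. -/
theorem exists_path_polynomials {R G : Type*} [CommRing R] [Fintype G] [DecidableEq G]
    {r : G → G → Prop} (hr : WellFounded r) (B : G → G → R) (hB : ∀ u x, ¬ r x u → B u x = 0) :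
    ∃ Q : G → G → R, ∀ u w, Q u w = (if u = w then 1 else 0) + ∑ x, B u x * Q x w := by
  classical
  refine ⟨fun u w => hr.fix (C := fun _ => R) (fun u ih => (if u = w then 1 else 0) +
    ∑ x, if h : r x u then B u x * ih x h else 0) u, fun u w => ?_⟩
  dsimp only
  rw [hr.fix_eq]
  congr 1
  refine Finset.sum_congr rfl fun x _ => ?_
  split_ifs with h
  · rfl
  · rw [hB u x h, zero_mul]

/-- Unfold the recursion as long as the degree exceeds `m`. Each path then stops at its one edge
from a vertex `w` above `m` to a vertex `x` not above `m`. By `hd`, a path ending above `m` never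
leaves that region, so the weight in front of this edge is all of `Q u w`. -/
theorem eq_sum_frontier {R G : Type*} [CommRing R] [Fintype G] [DecidableEq G]
    {r : G → G → Prop} (hr : WellFounded r) {B Q : G → G → R} (hB : ∀ u x, ¬ r x u → B u x = 0)
    (hQ : ∀ u w, Q u w = (if u = w then 1 else 0) + ∑ x, B u x * Q x w) {d : G → ℕ}
    (hd : ∀ u w, d u < d w → Q u w = 0) {m : ℕ} {X : G → R}
    (hX : ∀ u, m < d u → X u = ∑ x, B u x * X x) (u : G) (hu : m < d u) :
    X u = ∑ w with m < d w, Q u w * ∑ x with d x ≤ m, B w x * X x := by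
  induction u using hr.induction with
  | _ u ih =>
    set T : G → R := fun w => ∑ x with d x ≤ m, B w x * X x with hT
    have key : ∀ x, B u x * ∑ w with m < d w, Q x w * T w =
        if d x ≤ m then 0 else B u x * X x := by
      intro x
      split_ifs with h
      · rw [Finset.sum_eq_zero, mul_zero]
        intro w hw
        rw [hd x w (h.trans_lt (Finset.mem_filter.1 hw).2), zero_mul]
      · by_cases hxu : r x u
        · rw [← ih x hxu (not_le.1 h)]
        · rw [hB u x hxu, zero_mul, zero_mul]
    calc X u = ∑ x, B u x * X x := hX u hu
      _ = T u + ∑ x, if d x ≤ m then 0 else B u x * X x := by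
        rw [hT]
        simp only [Finset.sum_filter]
        rw [← Finset.sum_add_distrib]
        refine Finset.sum_congr rfl fun x _ => ?_
        split_ifs <;> simp
      _ = T u + ∑ w with m < d w, (∑ x, B u x * Q x w) * T w := by
        congr 1
        simp only [← key, Finset.mul_sum, Finset.sum_mul]
        rw [Finset.sum_comm]
        simp only [mul_assoc]
      _ = ∑ w with m < d w, Q u w * T w := by
        simp only [hQ u, add_mul, Finset.sum_add_distrib, ite_mul, one_mul, zero_mul]
        rw [Finset.sum_ite_eq, if_pos (by simpa using hu)]

end Frontier

/-! ### Counting expansions by a potential. -/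

/-- A bound for the number of expansions that bring all degrees from `e` down to at most `t`. -/
def expansionBound (t j e : ℕ) : ℕ := if e ≤ t then 0 else 3 * e / t - j

/-- Floors are superadditive, so only the offsets matter. The third degree `c`, that of the edge
weight, need not be halved. If it is the only one above `t`, the step costs one unit, which is the
gap between the offset `2` for gates and `1` for paths. -/
theorem expansionBound_step_path {t e a b c : ℕ} (ht : 0 < t) (he : t < e) (hs : a + b + c = e)
    (ha : a ≤ e / 2) (hb : b ≤ e / 2) :
    expansionBound t 1 a + expansionBound t 1 b + expansionBound t 2 c + 1 ≤
      expansionBound t 1 e := by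
  have h0 : 3 * a / t + 3 * b / t + 3 * c / t ≤ 3 * e / t :=
    calc 3 * a / t + 3 * b / t + 3 * c / t ≤ (3 * a + 3 * b) / t + 3 * c / t :=
          Nat.add_le_add_right (Nat.div_add_div_le_add_div) _
      _ ≤ (3 * a + 3 * b + 3 * c) / t := Nat.div_add_div_le_add_div
      _ = 3 * e / t := by congr 1; omega
  -- The factor `3` keeps the truncated subtraction of the offset harmless and pays for a step that
  -- leaves no heavy part.
  have h3 : ∀ x, t < x → 3 ≤ 3 * x / t := fun x hx => (Nat.le_div_iff_mul_le ht).2 (by omega)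
  have h4 := h3 e he
  have ha3 := h3 a
  have hb3 := h3 b
  have hc3 := h3 c
  -- A heavy part of at most half the degree leaves more than `t` for the rest, hence three spare
  -- units.
  have h5 : t < a → 3 * a / t + 3 ≤ 3 * e / t := fun h => by
    rw [← Nat.add_mul_div_right _ _ ht]; exact Nat.div_le_div_right (by omega)
  have h6 : t < b → 3 * b / t + 3 ≤ 3 * e / t := fun h => by
    rw [← Nat.add_mul_div_right _ _ ht]; exact Nat.div_le_div_right (by omega)
  unfold expansionBound
  generalize 3 * a / t = a', 3 * b / t = b', 3 * c / t = c', 3 * e / t = e' at *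
  split_ifs <;> omega

theorem expansionBound_step_gate {t e a b c : ℕ} (ht : 0 < t) (he : t < e) (hs : a + b + c = e)
    (ha : a ≤ e / 2) (hb : b ≤ e / 2) (hc : c ≤ e / 2) :
    expansionBound t 1 a + expansionBound t 2 b + expansionBound t 2 c + 1 ≤
      expansionBound t 2 e := by
  have h0 : 3 * a / t + 3 * b / t + 3 * c / t ≤ 3 * e / t :=
    calc 3 * a / t + 3 * b / t + 3 * c / t ≤ (3 * a + 3 * b) / t + 3 * c / t :=
          Nat.add_le_add_right (Nat.div_add_div_le_add_div) _
      _ ≤ (3 * a + 3 * b + 3 * c) / t := Nat.div_add_div_le_add_div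
      _ = 3 * e / t := by congr 1; omega
  have h3 : ∀ x, t < x → 3 ≤ 3 * x / t := fun x hx => (Nat.le_div_iff_mul_le ht).2 (by omega)
  have h4 := h3 e he
  have ha3 := h3 a
  have hb3 := h3 b
  have hc3 := h3 c
  have h5 : ∀ x, t < x → x ≤ e / 2 → 3 * x / t + 3 ≤ 3 * e / t := fun x h h' => by
    rw [← Nat.add_mul_div_right _ _ ht]; exact Nat.div_le_div_right (by omega)
  have ha5 := h5 a
  have hb5 := h5 b
  have hc5 := h5 c
  unfold expansionBound
  generalize 3 * a / t = a', 3 * b / t = b', 3 * c / t = c', 3 * e / t = e' at *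
  split_ifs <;> omega

theorem sum_frontier_eq {F R G : Type*} [CommRing F] [CommRing R] [Algebra F R] [Fintype G]
    {d : G → ℕ} {f : G → R} {c : G → G → G → F} (m : ℕ) (q X : G → R) :
    ∑ w with m < d w, q w * ∑ x with d x ≤ m, (∑ y, c w x y • f y) * X x =
      ∑ z : G × G × G, if m < d z.1 ∧ d z.2.1 ≤ m then
        c z.1 z.2.1 z.2.2 • (q z.1 * X z.2.1 * f z.2.2) else 0 := by
  simp only [Fintype.sum_prod_type, Finset.sum_filter, Finset.mul_sum, Finset.sum_mul]
  refine Finset.sum_congr rfl fun w _ => ?_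
  by_cases hw : m < d w
  · simp only [hw, true_and, if_true]
    refine Finset.sum_congr rfl fun x _ => ?_
    by_cases hx : d x ≤ m
    · simp only [hx, if_true, Finset.mul_sum]
      refine Finset.sum_congr rfl fun y _ => ?_
      rw [smul_mul_assoc, mul_smul_comm]
      congr 1
      ring
    · simp [hx]
  · simp [hw]

/-! ### Decomposition of a homogeneous quadratic system. -/

section Decomposition

variable {F R G : Type*} [CommRing F] [CommRing R] [Algebra F R] {S : Submodule F R}
  [Fintype G] [DecidableEq G] {r : G → G → Prop} {d : G → ℕ} {f : G → R} {c : G → G → G → F}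

theorem path_eq_zero_of_degree_lt (hr : WellFounded r)
    (hc : ∀ u x y, c u x y ≠ 0 → d x + d y = d u ∧ d y ≤ d x ∧ r x u) {Q : G → G → R}
    (hQ : ∀ u w, Q u w = (if u = w then 1 else 0) + ∑ x, (∑ y, c u x y • f y) * Q x w)
    (u w : G) (h : d u < d w) : Q u w = 0 := by
  induction u using hr.induction with
  | _ u ih =>
    rw [hQ, if_neg (by rintro rfl; exact lt_irrefl _ h), zero_add]
    refine Finset.sum_eq_zero fun x _ => ?_
    rw [Finset.sum_mul]
    refine Finset.sum_eq_zero fun y _ => ?_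
    by_cases h0 : c u x y = 0
    · simp [h0]
    · obtain ⟨h1, h2, h3⟩ := hc u x y h0
      rw [ih x h3 (by omega), mul_zero]

theorem path_mem_pow (hr : WellFounded r) (hf : ∀ u, f u ∈ S ^ d u)
    (hc : ∀ u x y, c u x y ≠ 0 → d x + d y = d u ∧ d y ≤ d x ∧ r x u) {Q : G → G → R}
    (hQ : ∀ u w, Q u w = (if u = w then 1 else 0) + ∑ x, (∑ y, c u x y • f y) * Q x w)
    (u w : G) (h : d w ≤ d u) : Q u w ∈ S ^ (d u - d w) := by
  induction u using hr.induction with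
  | _ u ih =>
    rw [hQ]
    refine add_mem ?_ (sum_mem fun x _ => ?_)
    · split_ifs with h'
      · subst h'
        simpa using (Submodule.one_le (P := (1 : Submodule F R))).1 le_rfl
      · exact zero_mem _
    · rw [Finset.sum_mul]
      refine sum_mem fun y _ => ?_
      by_cases h0 : c u x y = 0
      · simp [h0]
      · obtain ⟨h1, h2, h3⟩ := hc u x y h0
        rcases lt_or_ge (d x) (d w) with hx | hx
        · rw [path_eq_zero_of_degree_lt hr hc hQ x w hx, mul_zero]
          exact zero_mem _
        · rw [smul_mul_assoc, show d u - d w = d y + (d x - d w) by omega, pow_add]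
          exact Submodule.smul_mem _ _ (Submodule.mul_mem_mul (hf y) (ih x h3 hx))

/-- Every value of a homogeneous well-founded quadratic system of `|G|` equations is a short sum
of products of few factors of degree at most `t`. -/
theorem isSumBoundedProd_of_system (hr : WellFounded r) (hf : ∀ u, f u ∈ S ^ d u)
    (hc : ∀ u x y, c u x y ≠ 0 → d x + d y = d u ∧ d y ≤ d x ∧ r x u)
    (hrec : ∀ u, 2 ≤ d u → f u = ∑ x, (∑ y, c u x y • f y) * f x) {t : ℕ} (ht : 0 < t) (u : G) :
    IsSumBoundedProd S t ((Fintype.card G ^ 3) ^ expansionBound t 2 (d u))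
      (2 * expansionBound t 2 (d u) + 1) (d u) (f u) := by
  set M := Fintype.card G ^ 3 with hMdef
  have hM : 1 ≤ M := Nat.one_le_pow _ _ (Fintype.card_pos_iff.2 ⟨u⟩)
  have hcard : Fintype.card (G × G × G) = M := by simp [hMdef]; ring
  have hB : ∀ u x, ¬ r x u → ∑ y, c u x y • f y = 0 := fun u x hx =>
    Finset.sum_eq_zero fun y _ => by
      rw [show c u x y = 0 from by_contra fun h => hx (hc u x y h).2.2, zero_smul]
  obtain ⟨Q, hQ⟩ := exists_path_polynomials hr (fun u x => ∑ y, c u x y • f y) hB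
  have hd := path_eq_zero_of_degree_lt hr hc hQ
  have hcollect : ∀ {N e : ℕ} {p : G × G × G → R}, 1 ≤ N →
      (∀ z, IsSumBoundedProd S t (M ^ (N - 1)) (2 * N + 1) e (p z)) →
      IsSumBoundedProd S t (M ^ N) (2 * N + 1) e (∑ z, p z) := fun {N e p} hN h => by
    have := IsSumBoundedProd.finset_sum Finset.univ (fun z _ => h z)
    rwa [Finset.card_univ, hcard, ← pow_succ', Nat.sub_add_cancel hN] at this
  have main : ∀ e, (∀ u, d u = e → IsSumBoundedProd S t (M ^ expansionBound t 2 e)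
        (2 * expansionBound t 2 e + 1) e (f u)) ∧
      ∀ u v, d v ≤ d u → d u - d v = e → IsSumBoundedProd S t (M ^ expansionBound t 1 e)
        (2 * expansionBound t 1 e + 1) e (Q u v) := by
    intro e
    induction e using Nat.strong_induction_on with
    | _ e ih =>
    rcases le_or_gt e t with het | het
    · have hb : ∀ j, expansionBound t j e = 0 := fun j => if_pos het
      rw [hb, hb]
      refine ⟨fun u hu => ?_, fun u v huv he => ?_⟩
      · simpa using IsSumBoundedProd.of_mem het (hu ▸ hf u)
      · simpa using IsSumBoundedProd.of_mem het (he ▸ path_mem_pow hr hf hc hQ u v huv)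
    have hgate : ∀ u, d u = e → IsSumBoundedProd S t (M ^ expansionBound t 2 e)
        (2 * expansionBound t 2 e + 1) e (f u) := by
      intro u hu
      -- Since `1 ≤ t < e`, every vertex above the cut has degree at least two, so its equation is
      -- available.
      rw [eq_sum_frontier hr hB hQ hd (m := e / 2) (fun v hv => hrec v (by omega)) u (by omega),
        sum_frontier_eq]
      refine hcollect ?_ fun z => ?_
      -- An arbitrary admissible splitting, used only to see that the bound at `e` is positive.
      · have := expansionBound_step_gate ht het (a := e - e / 2 - e / 2) (b := e / 2) (c := e / 2)
          (by omega) (by omega) (by omega) (by omega)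
        omega
      · obtain ⟨w, x, y⟩ := z
        dsimp only
        split_ifs with h
        · by_cases h0 : c w x y = 0
          · rw [h0, zero_smul]; exact .zero _ _ _
          obtain ⟨h1, h2, h3⟩ := hc w x y h0
          rcases lt_or_ge (d u) (d w) with huw | huw
          · rw [hd u w huw, zero_mul, zero_mul, smul_zero]; exact .zero _ _ _
          have hsum : (d u - d w) + d x + d y = e := by omega
          have := IsSumBoundedProd.smul_mul_mul (c w x y) hM
            ((ih (d u - d w) (by omega)).2 u w huw rfl) ((ih (d x) (by omega)).1 x rfl)
            ((ih (d y) (by omega)).1 y rfl)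
            (expansionBound_step_gate ht het hsum (by omega) (by omega) (by omega))
          rwa [hsum] at this
        · exact .zero _ _ _
    refine ⟨hgate, fun u v huv he => ?_⟩
    -- Above this cut no vertex equals `v`, so the column `Q · v` satisfies the homogeneous
    -- recursion there.
    rw [eq_sum_frontier hr hB hQ hd (m := d v + e / 2) (X := fun x => Q x v)
      (fun w hw => by rw [hQ, if_neg (by rintro rfl; omega), zero_add]) u (by omega),
      sum_frontier_eq]
    refine hcollect ?_ fun z => ?_
    · have := expansionBound_step_path ht het (a := e - e / 2 - e / 2) (b := e / 2) (c := e / 2)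
        (by omega) (by omega) (by omega)
      omega
    · obtain ⟨w, x, y⟩ := z
      dsimp only
      split_ifs with h
      · by_cases h0 : c w x y = 0
        · rw [h0, zero_smul]; exact .zero _ _ _
        obtain ⟨h1, h2, h3⟩ := hc w x y h0
        rcases lt_or_ge (d u) (d w) with huw | huw
        · rw [hd u w huw, zero_mul, zero_mul, smul_zero]; exact .zero _ _ _
        rcases lt_or_ge (d x) (d v) with hxv | hxv
        · rw [hd x v hxv, mul_zero, zero_mul, smul_zero]; exact .zero _ _ _
        have hsum : (d u - d w) + (d x - d v) + d y = e := by omega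
        -- The edge weight may carry the full degree `e`; this is why the gates of degree `e` are
        -- settled before the paths.
        have hy : IsSumBoundedProd S t (M ^ expansionBound t 2 (d y))
            (2 * expansionBound t 2 (d y) + 1) (d y) (f y) := by
          rcases (show d y ≤ e by omega).lt_or_eq with hlt | heq
          · exact (ih (d y) hlt).1 y rfl
          · rw [heq]; exact hgate y heq
        have := IsSumBoundedProd.smul_mul_mul (c w x y) hM
          ((ih (d u - d w) (by omega)).2 u w huw rfl) ((ih (d x - d v) (by omega)).2 x v hxv rfl)
          hy (expansionBound_step_path ht het hsum (by omega) (by omega))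
        rwa [hsum] at this
      · exact .zero _ _ _
  exact (main (d u)).1 u rfl

end Decomposition

/-! ### Homogeneous components of polynomials. -/

theorem MvPolynomial.homogeneousComponent_mul {σ R : Type*} [CommSemiring R] (e : ℕ)
    (p q : MvPolynomial σ R) : homogeneousComponent e (p * q) =
      ∑ z ∈ Finset.HasAntidiagonal.antidiagonal e, homogeneousComponent z.1 p * homogeneousComponent z.2 q := by
  classical
  ext m
  simp only [coeff_homogeneousComponent, coeff_sum, coeff_mul]
  rw [Finset.sum_comm, Finset.ite_sum_zero]
  refine Finset.sum_congr rfl fun x hx => ?_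
  have hdeg : x.1.degree + x.2.degree = m.degree := by
    rw [← Finset.HasAntidiagonal.mem_antidiagonal.1 hx, map_add]
  simp only [ite_mul, mul_ite, zero_mul, mul_zero]
  split_ifs with h
  · rw [Finset.sum_eq_single (x.1.degree, x.2.degree)]
    · simp
    · rintro ⟨i, j⟩ hij hne
      by_cases h1 : x.1.degree = i
      · have h2 : x.2.degree ≠ j := fun h2 => hne (by rw [h1, h2])
        simp [h2]
      · simp [h1]
    · intro h'
      exact absurd (Finset.HasAntidiagonal.mem_antidiagonal.2 (hdeg.trans h)) h'
  · symm
    refine Finset.sum_eq_zero fun z hz => ?_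
    have := Finset.HasAntidiagonal.mem_antidiagonal.1 hz
    by_cases h1 : x.1.degree = z.1
    · have h2 : x.2.degree ≠ z.2 := by omega
      simp [h2]
    · simp [h1]

theorem MvPolynomial.homogeneousComponent_mem_span_X_pow {σ F : Type*} [CommRing F] {W : Set σ}
    {p : MvPolynomial σ F} (hp : p ∈ Algebra.adjoin F (X '' W : Set (MvPolynomial σ F))) (e : ℕ) :
    homogeneousComponent e p ∈ Submodule.span F (X '' W : Set (MvPolynomial σ F)) ^ e := by
  induction hp using Algebra.adjoin_induction generalizing e with
  | mem x hx =>
    obtain ⟨i, hi, rfl⟩ := hx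
    rw [homogeneousComponent_of_mem ((mem_homogeneousSubmodule _ _).2 (isHomogeneous_X F i))]
    split_ifs with h
    · subst h
      rw [pow_one]
      exact Submodule.subset_span ⟨i, hi, rfl⟩
    · exact zero_mem _
  | algebraMap r =>
    rw [algebraMap_eq,
      homogeneousComponent_of_mem ((mem_homogeneousSubmodule _ _).2 (isHomogeneous_C σ r))]
    split_ifs with h
    · subst h
      rw [pow_zero, ← algebraMap_eq]
      exact Submodule.algebraMap_mem r
    · exact zero_mem _
  | add x y _ _ hx hy => rw [map_add]; exact add_mem (hx e) (hy e)
  | mul x y _ _ hx hy =>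
    rw [homogeneousComponent_mul]
    refine sum_mem fun z hz => ?_
    rw [← Finset.HasAntidiagonal.mem_antidiagonal.1 hz, pow_add]
    exact Submodule.mul_mem_mul (hx _) (hy _)

/-! ### The quadratic system of a circuit. -/

namespace Circuit

/-- The order in which the components are computed. -/
def ComponentLT {F : Type u} {σ : Type v} (C : Circuit F σ) (s d : ℕ) (x u : C.V × Fin (s + 1) × Fin (d + 1)) : Prop :=
  Prod.Lex (fun a b : C.V => a ∈ (C.gate b).children) (fun i j : ℕ => i < j)
    (x.1, (x.2.1 : ℕ)) (u.1, (u.2.1 : ℕ))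

theorem wellFounded_componentLT {F : Type u} {σ : Type v} (C : Circuit F σ) (s d : ℕ) :
    WellFounded (C.ComponentLT s d) :=
  InvImage.wf (fun x : C.V × Fin (s + 1) × Fin (d + 1) => (x.1, (x.2.1 : ℕ)))
    (WellFounded.prod_lex C.acyclic Nat.lt_wfRel.wf)

variable {F : Type u} [Field F] {σ : Type v} (C : Circuit F σ)

/-- The variables that occur in the circuit. -/
def vars : Set σ := {i | ∃ a, C.gate a = .var i}

/-- The span of the variables that occur in the circuit. -/
noncomputable def linearForms : Submodule F (MvPolynomial σ F) :=
  Submodule.span F (MvPolynomial.X '' C.vars)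

theorem eval_mem_adjoin (a : C.V) :
    C.eval a ∈ Algebra.adjoin F (MvPolynomial.X '' C.vars : Set (MvPolynomial σ F)) := by
  induction a using C.acyclic.induction with
  | _ a ih =>
    rw [eval_eq]
    cases hg : C.gate a with
    | var i => exact Algebra.subset_adjoin ⟨i, ⟨a, hg⟩, rfl⟩
    | const x => exact Subalgebra.algebraMap_mem _ x
    | add l =>
      refine list_sum_mem fun q hq => ?_
      obtain ⟨p, hp, rfl⟩ := List.mem_map.1 hq
      refine mul_mem (Subalgebra.algebraMap_mem _ p.1) (ih p.2 ?_)
      rw [hg]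
      exact List.mem_map_of_mem hp
    | mul l =>
      refine list_prod_mem fun q hq => ?_
      obtain ⟨b, hb, rfl⟩ := List.mem_map.1 hq
      exact ih b (by rw [hg]; exact hb)

/-- The product of the first `i` children of a product gate. At the other gates this is `1` for
`i = 0` and the value of the gate otherwise. -/
noncomputable def prefixValue (a : C.V) (i : ℕ) : MvPolynomial σ F :=
  match C.gate a with
  | .mul l => ((l.take i).map C.eval).prod
  | _ => if i = 0 then 1 else C.eval a

theorem prefixValue_zero (a : C.V) : C.prefixValue a 0 = 1 := by
  unfold prefixValue
  split <;> simp

/-- With every fan-in at most `s` and `s ≠ 0`, the last index `s` thus represents the full value of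
every gate, input gates included. -/
theorem prefixValue_eq_eval {a : C.V} {i : ℕ} (hi : C.fanIn a ≤ i) (h0 : i ≠ 0) :
    C.prefixValue a i = C.eval a := by
  unfold prefixValue
  split
  · next l hl =>
    rw [eval_eq, hl]
    simp only [fanIn, hl, Gate.children] at hi
    simp [List.take_of_length_le hi]
  · simp [h0]

theorem prefixValue_mem_adjoin (a : C.V) (i : ℕ) : C.prefixValue a i ∈
    Algebra.adjoin F (MvPolynomial.X '' C.vars : Set (MvPolynomial σ F)) := by
  unfold prefixValue
  split
  · refine list_prod_mem fun q hq => ?_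
    obtain ⟨b, hb, rfl⟩ := List.mem_map.1 hq
    exact C.eval_mem_adjoin b
  · split_ifs
    · exact one_mem _
    · exact C.eval_mem_adjoin a

/-- The homogeneous components of the prefix values, up to degree `d`. -/
noncomputable def component (s d : ℕ) (u : C.V × Fin (s + 1) × Fin (d + 1)) : MvPolynomial σ F :=
  MvPolynomial.homogeneousComponent u.2.2 (C.prefixValue u.1 u.2.1)

/-- A prefix product is the previous prefix times one child, and a sum gate is linear in its
children; both only involve earlier components. Only the factor of larger degree has to be earlier,
which leaves the other free to be a constant `1`. -/
theorem component_mem_span {s d : ℕ} (hs : ∀ a, C.fanIn a ≤ s) (hs0 : s ≠ 0)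
    (u : C.V × Fin (s + 1) × Fin (d + 1)) (hu : 2 ≤ (u.2.2 : ℕ)) :
    C.component s d u ∈ Submodule.span F ((fun z : (C.V × Fin (s + 1) × Fin (d + 1)) ×
        (C.V × Fin (s + 1) × Fin (d + 1)) => C.component s d z.2 * C.component s d z.1) ''
      {z | (z.1.2.2 : ℕ) + z.2.2.2 = u.2.2 ∧ (z.2.2.2 : ℕ) ≤ z.1.2.2 ∧
        C.ComponentLT s d z.1 u}) := by
  set T := Submodule.span F ((fun z : (C.V × Fin (s + 1) × Fin (d + 1)) ×
        (C.V × Fin (s + 1) × Fin (d + 1)) => C.component s d z.2 * C.component s d z.1) ''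
      {z | (z.1.2.2 : ℕ) + z.2.2.2 = u.2.2 ∧ (z.2.2.2 : ℕ) ≤ z.1.2.2 ∧ C.ComponentLT s d z.1 u})
    with hT
  have hpair : ∀ x y, (x.2.2 : ℕ) + y.2.2 = u.2.2 → C.ComponentLT s d x u →
      C.ComponentLT s d y u → C.component s d x * C.component s d y ∈ T := by
    intro x y hxy hx hy
    rcases le_total (x.2.2 : ℕ) y.2.2 with h | h
    · exact Submodule.subset_span ⟨(y, x), ⟨by dsimp only; omega, h, hy⟩, rfl⟩
    · rw [mul_comm]
      exact Submodule.subset_span ⟨(x, y), ⟨hxy, h, hx⟩, rfl⟩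
  have hone : ∀ x, (x.2.2 : ℕ) = u.2.2 → C.ComponentLT s d x u → C.component s d x ∈ T := by
    intro x hxu hx
    -- The empty prefix at any gate has degree-`0` component `1`, which turns a single component
    -- into a product of two.
    refine Submodule.subset_span ⟨(x, (C.out, 0, 0)), ⟨by simpa using hxu, by simp, hx⟩, ?_⟩
    simp [component, prefixValue_zero]
  have hchild : ∀ b ∈ (C.gate u.1).children,
      MvPolynomial.homogeneousComponent u.2.2 (C.eval b) ∈ T := by
    intro b hb
    have := hone (b, Fin.last s, u.2.2) rfl (Prod.Lex.left _ _ hb)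
    rwa [component, Fin.val_last, prefixValue_eq_eval C (hs b) hs0] at this
  obtain ⟨a, i, e⟩ := u
  dsimp only at *
  have hconst : ∀ x : F, MvPolynomial.homogeneousComponent e (MvPolynomial.C x) =
      (0 : MvPolynomial σ F) := fun x => by
    rw [MvPolynomial.homogeneousComponent_of_mem
      ((MvPolynomial.mem_homogeneousSubmodule _ _).2 (MvPolynomial.isHomogeneous_C σ x)),
      if_neg (by omega)]
  rcases Nat.eq_zero_or_pos (i : ℕ) with hi | hi
  · rw [component]
    dsimp only
    rw [hi, prefixValue_zero, ← MvPolynomial.C_1, hconst]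
    exact zero_mem _
  rw [component]
  dsimp only
  cases hg : C.gate a with
  | var j =>
    rw [prefixValue_eq_eval C (by simp [fanIn, hg, Gate.children]) hi.ne', eval_eq, hg]
    dsimp only
    rw [MvPolynomial.homogeneousComponent_of_mem
      ((MvPolynomial.mem_homogeneousSubmodule _ _).2 (MvPolynomial.isHomogeneous_X F j)),
      if_neg (by omega)]
    exact zero_mem _
  | const x =>
    rw [prefixValue_eq_eval C (by simp [fanIn, hg, Gate.children]) hi.ne', eval_eq, hg]
    dsimp only
    rw [hconst]
    exact zero_mem _
  | add l =>
    have : C.prefixValue a i = C.eval a := by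
      unfold prefixValue
      rw [hg]
      simp [hi.ne']
    rw [this, eval_eq, hg]
    dsimp only
    rw [map_list_sum]
    refine list_sum_mem fun q hq => ?_
    obtain ⟨q', hq', rfl⟩ := List.mem_map.1 hq
    obtain ⟨p, hp, rfl⟩ := List.mem_map.1 hq'
    rw [MvPolynomial.homogeneousComponent_C_mul, ← MvPolynomial.smul_eq_C_mul]
    refine Submodule.smul_mem _ _ (hchild p.2 ?_)
    rw [hg]
    exact List.mem_map_of_mem hp
  | mul l =>
    have hlt : (i : ℕ) - 1 < s + 1 := by omega
    have hprev : ∀ e', C.ComponentLT s d (a, ⟨i - 1, hlt⟩, e') (a, i, e) := fun e' =>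
      Prod.Lex.right _ (by dsimp only; omega)
    have hval : ∀ j, C.prefixValue a j = ((l.take j).map C.eval).prod := fun j => by
      unfold prefixValue
      rw [hg]
    rcases lt_or_ge ((i : ℕ) - 1) l.length with hil | hil
    · have : C.prefixValue a i = C.prefixValue a (i - 1) * C.eval l[(i : ℕ) - 1] := by
        rw [hval, hval]
        conv_lhs => rw [← Nat.sub_add_cancel hi, List.take_add_one]
        simp [hil]
      rw [this, MvPolynomial.homogeneousComponent_mul]
      refine sum_mem fun z hz => ?_
      have hz' := Finset.HasAntidiagonal.mem_antidiagonal.1 hz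
      have := hpair (a, ⟨i - 1, hlt⟩, ⟨z.1, by omega⟩) (l[(i : ℕ) - 1], Fin.last s, ⟨z.2, by omega⟩)
        hz' (hprev _) (Prod.Lex.left _ _ (by
          dsimp only; rw [hg]; exact List.getElem_mem hil))
      simpa only [component, Fin.val_last, prefixValue_eq_eval C (hs _) hs0] using this
    -- Past the end of the list of children the prefix product no longer changes.
    · have := hone (a, ⟨i - 1, hlt⟩, e) rfl (hprev _)
      rw [component] at this
      dsimp only at this
      rwa [hval, List.take_of_length_le hil, ← List.take_of_length_le (hil.trans (Nat.sub_le i 1)),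
        ← hval] at this

/-- The homogeneous components of the output of a circuit are short sums of products of few
factors of degree at most `t` in the variables of the circuit. -/
theorem isSumBoundedProd_homogeneousComponent {s d t e : ℕ} (hs : C.size ≤ s) (ht : 0 < t)
    (he : e ≤ d) : IsSumBoundedProd C.linearForms t
      (((s * ((s + 1) * (d + 1))) ^ 3) ^ expansionBound t 2 e) (2 * expansionBound t 2 e + 1) e
      (MvPolynomial.homogeneousComponent e (C.eval C.out)) := by
  classical
  have hV : Fintype.card C.V ≤ s := (Nat.le_add_right _ _).trans hs
  have hs0 : s ≠ 0 := by
    have : 0 < Fintype.card C.V := Fintype.card_pos_iff.2 ⟨C.out⟩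
    omega
  have hfan : ∀ a, C.fanIn a ≤ s := fun a =>
    ((Finset.single_le_sum (f := C.fanIn) (fun _ _ => Nat.zero_le _) (Finset.mem_univ a)).trans
      (Nat.le_add_left _ _)).trans hs
  have hex : ∀ u : C.V × Fin (s + 1) × Fin (d + 1), ∃ c : (C.V × Fin (s + 1) × Fin (d + 1)) →
      (C.V × Fin (s + 1) × Fin (d + 1)) → F,
      (∀ x y, c x y ≠ 0 → (x.2.2 : ℕ) + y.2.2 = u.2.2 ∧ (y.2.2 : ℕ) ≤ x.2.2 ∧
        C.ComponentLT s d x u) ∧ (2 ≤ (u.2.2 : ℕ) → C.component s d u =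
        ∑ x, (∑ y, c x y • C.component s d y) * C.component s d x) := by
    intro u
    by_cases hu : 2 ≤ (u.2.2 : ℕ)
    · obtain ⟨l, hl, hl'⟩ := (Finsupp.mem_span_image_iff_linearCombination F).1
        (C.component_mem_span hfan hs0 u hu)
      refine ⟨fun x y => l (x, y), fun x y hxy => ?_, fun _ => ?_⟩
      · exact (Finsupp.mem_supported _ _).1 hl (Finsupp.mem_support_iff.2 hxy)
      · rw [← hl', Finsupp.linearCombination_apply, Finsupp.sum_fintype _ _ (by simp),
          Fintype.sum_prod_type]
        simp only [Finset.sum_mul, smul_mul_assoc]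
    -- Below degree two no equation is needed: such components are never expanded, because `t ≥ 1`.
    · exact ⟨fun _ _ => 0, by simp, fun h => absurd h hu⟩
  choose c hc hrec using hex
  have key := isSumBoundedProd_of_system (S := C.linearForms) (f := C.component s d)
    (d := fun u : C.V × Fin (s + 1) × Fin (d + 1) => (u.2.2 : ℕ)) (C.wellFounded_componentLT s d)
    (fun u => MvPolynomial.homogeneousComponent_mem_span_X_pow (C.prefixValue_mem_adjoin _ _) _)
    hc hrec ht (C.out, Fin.last s, ⟨e, by omega⟩)
  rw [component, Fin.val_last, prefixValue_eq_eval C (hfan _) hs0] at key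
  refine key.mono (Nat.pow_le_pow_left (Nat.pow_le_pow_left ?_ 3) _) le_rfl
  simpa using hV

end Circuit

/-! ### Construction of depth four circuits. -/

namespace Circuit

/-- The gates of a circuit with `A` products of `K` factors, each factor a linear combination of
words of length at most `t` over the alphabet `W`. -/
abbrev FourLevelGate (W : Type) (A K t : ℕ) : Type :=
  Unit ⊕ Fin A ⊕ (Fin A × Fin K) ⊕ (Σ e : Fin (t + 1), Fin e → W) ⊕ W

/-- The level of a gate, counted from the inputs. -/
def fourLevelHeight {W : Type} {A K t : ℕ} : FourLevelGate W A K t → ℕ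
  | .inl _ => 4
  | .inr (.inl _) => 3
  | .inr (.inr (.inl _)) => 2
  | .inr (.inr (.inr (.inl _))) => 1
  | .inr (.inr (.inr (.inr _))) => 0

/-- The labels of the gates of a depth four circuit. -/
noncomputable def fourLevelLabel {F : Type u} {σ : Type v} {W : Type} [Fintype W] {A K t : ℕ}
    (x : W → σ) (c : Fin A → F) (δ : Fin A → Fin K → Fin (t + 1))
    (a : ∀ i j, (Fin (δ i j) → W) → F) : FourLevelGate W A K t → Gate F σ (FourLevelGate W A K t)
  | .inl _ => .add (List.ofFn fun i => (c i, .inr (.inl i)))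
  | .inr (.inl i) => .mul (List.ofFn fun j => .inr (.inr (.inl (i, j))))
  | .inr (.inr (.inl (i, j))) => .add ((Finset.univ : Finset (Fin (δ i j) → W)).toList.map
      fun w => (a i j w, .inr (.inr (.inr (.inl ⟨δ i j, w⟩)))))
  | .inr (.inr (.inr (.inl z))) => .mul (List.ofFn fun p => .inr (.inr (.inr (.inr (z.2 p)))))
  | .inr (.inr (.inr (.inr y))) => .var (x y)

theorem fourLevelHeight_lt {F : Type u} {σ : Type v} {W : Type} [Fintype W] {A K t : ℕ}
    {x : W → σ} {c : Fin A → F} {δ : Fin A → Fin K → Fin (t + 1)}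
    {a : ∀ i j, (Fin (δ i j) → W) → F} {b b' : FourLevelGate W A K t}
    (h : b ∈ (fourLevelLabel x c δ a b').children) : fourLevelHeight b < fourLevelHeight b' := by
  rcases b' with _ | i | ⟨i, j⟩ | z | y <;>
    simp only [fourLevelLabel, Gate.children, List.mem_map, List.mem_ofFn, List.not_mem_nil] at h
  · obtain ⟨_, ⟨i, rfl⟩, rfl⟩ := h
    simp [fourLevelHeight]
  · obtain ⟨j, rfl⟩ := h
    simp [fourLevelHeight]
  · obtain ⟨_, ⟨w, -, rfl⟩, rfl⟩ := h
    simp [fourLevelHeight]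
  · obtain ⟨p, rfl⟩ := h
    simp [fourLevelHeight]

/-- A depth four circuit. -/
noncomputable abbrev fourLevel {F : Type u} {σ : Type v} {W : Type} [Fintype W] {A K t : ℕ}
    (x : W → σ) (c : Fin A → F) (δ : Fin A → Fin K → Fin (t + 1))
    (a : ∀ i j, (Fin (δ i j) → W) → F) : Circuit F σ where
  V := FourLevelGate W A K t
  fintypeV := inferInstance
  gate := fourLevelLabel x c δ a
  acyclic := Subrelation.wf fourLevelHeight_lt (measure fourLevelHeight).wf
  out := .inl ()

section

variable {F : Type u} {σ : Type v} {W : Type} [Fintype W] {A K t : ℕ}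
    (x : W → σ) (c : Fin A → F) (δ : Fin A → Fin K → Fin (t + 1))
    (a : ∀ i j, (Fin (δ i j) → W) → F)

theorem fourLevel_isSigmaPiSigmaPi : (fourLevel x c δ a).IsSigmaPiSigmaPi t := by
  refine ⟨_, rfl, fun q hq => ?_⟩
  obtain ⟨i, rfl⟩ := List.mem_ofFn.1 hq
  refine ⟨_, rfl, fun q hq => ?_⟩
  obtain ⟨j, rfl⟩ := List.mem_ofFn.1 hq
  refine ⟨_, rfl, fun q hq => ?_⟩
  obtain ⟨w, -, rfl⟩ := List.mem_map.1 hq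
  refine ⟨_, rfl, ?_, fun q hq => ?_⟩
  · rw [List.length_ofFn]
    exact Nat.lt_succ_iff.1 (δ i j).2
  · obtain ⟨p, rfl⟩ := List.mem_ofFn.1 hq
    exact .inl ⟨_, rfl⟩

/-- The degrees at the gates below the output, completed by the degree `e` at the output. -/
def fourLevelDegree (e : ℕ) : FourLevelGate W A K t → ℕ
  | .inl _ => e
  | .inr (.inl i) => ∑ j, (δ i j : ℕ)
  | .inr (.inr (.inl (i, j))) => δ i j
  | .inr (.inr (.inr (.inl z))) => z.1
  | .inr (.inr (.inr (.inr _))) => 1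

theorem fourLevel_respectsDegree (e : ℕ) (b : FourLevelGate W A K t) (hb : b ≠ .inl ()) :
    (fourLevel x c δ a).RespectsDegree (fourLevelDegree δ e) b := by
  rcases b with _ | i | ⟨i, j⟩ | z | y
  · exact absurd rfl hb
  · simp [RespectsDegree, fourLevel, fourLevelLabel, fourLevelDegree, List.map_ofFn,
      List.sum_ofFn]
  · intro q hq
    obtain ⟨w, -, rfl⟩ := List.mem_map.1 hq
    rfl
  · simp [RespectsDegree, fourLevel, fourLevelLabel, fourLevelDegree, List.map_ofFn,
      List.sum_ofFn]
  · simp [RespectsDegree, fourLevelLabel, fourLevelDegree]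

theorem fourLevel_isHomogeneousBelowOutput :
    (fourLevel x c δ a).IsHomogeneousBelowOutput :=
  ⟨fourLevelDegree δ 0, fun b hb => fourLevel_respectsDegree x c δ a 0 b hb⟩

theorem fourLevel_isHomogeneous {e : ℕ} (he : ∀ i, ∑ j, (δ i j : ℕ) = e) :
    (fourLevel x c δ a).IsHomogeneous := by
  refine ⟨fourLevelDegree δ e, fun b => ?_⟩
  by_cases hb : b = .inl ()
  · subst hb
    intro q hq
    obtain ⟨i, rfl⟩ := List.mem_ofFn.1 hq
    exact he i
  · exact fourLevel_respectsDegree x c δ a e b hb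

theorem fourLevel_topFanIn : (fourLevel x c δ a).topFanIn = A := by
  simp [topFanIn, fanIn, fourLevel, fourLevelLabel, Gate.children]

/-- The bottom product gates, one for each word, are shared by all factors, so only the wires into
the lower sum gates number up to `A * K * N`. -/
theorem fourLevel_size_le {w N : ℕ} (hw : Fintype.card W ≤ w)
    (hN : ∀ e ≤ t, Fintype.card W ^ e ≤ N) :
    (fourLevel x c δ a).size ≤
      1 + A + A * K + (t + 1) * N + w + (A + A * K + A * K * N + (t + 1) * N * t) := by
  have h1 : Fintype.card (Σ e : Fin (t + 1), Fin e → W) ≤ (t + 1) * N := by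
    rw [Fintype.card_sigma]
    refine (Finset.sum_le_card_nsmul _ _ N fun e _ => ?_).trans (by simp)
    simpa using hN e (Nat.lt_succ_iff.1 e.2)
  have hsize : (fourLevel x c δ a).size = Fintype.card (FourLevelGate W A K t) +
      ∑ b : FourLevelGate W A K t, (fourLevelLabel x c δ a b).children.length := rfl
  rw [hsize]
  refine add_le_add ?_ ?_
  · simp only [Fintype.card_sum, Fintype.card_prod, Fintype.card_fin, Fintype.card_unit]
    omega
  · have h2 : ∑ z : (Σ e : Fin (t + 1), Fin e → W), (z.1 : ℕ) ≤ (t + 1) * N * t :=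
      (Finset.sum_le_card_nsmul _ _ t fun z _ => Nat.lt_succ_iff.1 z.1.2).trans
        (by rw [smul_eq_mul, Finset.card_univ]; exact Nat.mul_le_mul_right t h1)
    have h3 : ∑ z : Fin A × Fin K, Fintype.card W ^ (δ z.1 z.2 : ℕ) ≤ A * K * N :=
      (Finset.sum_le_card_nsmul _ _ N fun z _ => hN _ (Nat.lt_succ_iff.1 (δ z.1 z.2).2)).trans
        (by simp)
    simp only [Fintype.sum_sum_type, fourLevelLabel, Gate.children, List.length_map,
      List.length_ofFn, Finset.length_toList, Finset.card_univ, Fintype.card_fun,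
      Fintype.card_fin, Finset.sum_const, Fintype.card_unit, smul_eq_mul, List.length_nil]
    omega

theorem fourLevel_computes [Field F] : (fourLevel x c δ a).Computes
    (∑ i, c i • ∏ j, ∑ w : Fin (δ i j) → W, a i j w • ∏ p, MvPolynomial.X (x (w p))) := by
  have h5 : ∀ y : W, (fourLevel x c δ a).eval (.inr (.inr (.inr (.inr y)))) =
      MvPolynomial.X (x y) := fun y => by
    exact eval_eq _ _
  have h4 : ∀ z, (fourLevel x c δ a).eval (.inr (.inr (.inr (.inl z)))) =
      ∏ p, MvPolynomial.X (x (z.2 p)) := fun z => by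
    refine (eval_eq _ _).trans ?_
    simp only [fourLevel, fourLevelLabel, List.map_ofFn, List.prod_ofFn]
    exact Finset.prod_congr rfl fun p _ => h5 _
  have h3 : ∀ i j, (fourLevel x c δ a).eval (.inr (.inr (.inl (i, j)))) =
      ∑ w : Fin (δ i j) → W, a i j w • ∏ p, MvPolynomial.X (x (w p)) := fun i j => by
    refine (eval_eq _ _).trans ?_
    simp only [fourLevel, fourLevelLabel, List.map_map, Finset.sum_map_toList]
    refine Finset.sum_congr rfl fun w _ => ?_
    rw [MvPolynomial.smul_eq_C_mul]
    exact congrArg _ (h4 ⟨δ i j, w⟩)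
  have h2 : ∀ i, (fourLevel x c δ a).eval (.inr (.inl i)) =
      ∏ j, ∑ w : Fin (δ i j) → W, a i j w • ∏ p, MvPolynomial.X (x (w p)) := fun i => by
    refine (eval_eq _ _).trans ?_
    simp only [fourLevel, fourLevelLabel, List.map_ofFn, List.prod_ofFn]
    exact Finset.prod_congr rfl fun j _ => h3 i j
  change (fourLevel x c δ a).eval (.inl ()) = _
  refine (eval_eq _ _).trans ?_
  simp only [fourLevel, fourLevelLabel, List.map_ofFn, List.sum_ofFn]
  refine Finset.sum_congr rfl fun i _ => ?_
  rw [MvPolynomial.smul_eq_C_mul]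
  exact congrArg _ (h2 i)

end

-- A power of a span is spanned by the products of generators. Words that differ by a permutation
-- are not identified; the count `|W|^e` is good enough.
open scoped Pointwise in
theorem exists_eq_sum_words {F σ W : Type*} [CommRing F] [Fintype W] (x : W → σ) {e : ℕ}
    {p : MvPolynomial σ F}
    (hp : p ∈ Submodule.span F (Set.range fun w => (MvPolynomial.X (x w) : MvPolynomial σ F)) ^ e) :
    ∃ a : (Fin e → W) → F, p = ∑ w, a w • ∏ i, MvPolynomial.X (x (w i)) := by
  have hset : (Set.range fun w => (MvPolynomial.X (x w) : MvPolynomial σ F)) ^ e ⊆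
      Set.range fun w : Fin e → W => ∏ i, (MvPolynomial.X (x (w i)) : MvPolynomial σ F) := by
    intro q hq
    obtain ⟨g, rfl⟩ := Set.mem_pow.1 hq
    choose w hw using fun i => (g i).2
    exact ⟨w, by simp [List.prod_ofFn, ← hw]⟩
  rw [Submodule.span_pow] at hp
  obtain ⟨a, ha⟩ := (Submodule.mem_span_range_iff_exists_fun F).1 (Submodule.span_mono hset hp)
  exact ⟨a, ha.symm⟩

end Circuit

/-! ### From a circuit to its depth four form. -/

namespace Circuit

/-- The alphabet of words consists of the variables that occur, at most `s` of them, so `n` does not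
enter the size bound. -/
theorem exists_injective_vars {F : Type u} {σ : Type v} (C : Circuit F σ) :
    ∃ g : C.vars → C.V, Function.Injective g := by
  choose g hg using fun i : C.vars => i.2
  refine ⟨g, fun i j hij => ?_⟩
  have := (hg i).symm.trans ((congrArg C.gate hij).trans (hg j))
  exact Subtype.ext (Gate.var.inj this)

/-- A linear combination of products of `K` factors of degree at most `t` in the variables of `C`
is computed by a depth four circuit. -/
theorem exists_sigmaPiSigmaPi {F : Type u} [Field F] {σ : Type} (C : Circuit F σ) {s t K : ℕ}
    (hs : C.size ≤ s) (L : List (F × MvPolynomial σ F)) (P : ℕ → Prop)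
    (hL : ∀ q ∈ L, ∃ e, P e ∧ IsBoundedProd C.linearForms t K e q.2) :
    ∃ D : Circuit F σ, D.Computes (L.map fun q => q.1 • q.2).sum ∧ D.IsSigmaPiSigmaPi t ∧
      D.IsHomogeneousBelowOutput ∧ (∀ e, (∀ e', P e' → e' = e) → D.IsHomogeneous) ∧
      D.topFanIn = L.length ∧
      D.size ≤ 1 + L.length + L.length * K + (t + 1) * s ^ t + s +
        (L.length + L.length * K + L.length * K * s ^ t + (t + 1) * s ^ t * t) := by
  classical
  have hV : Fintype.card C.V ≤ s := (Nat.le_add_right _ _).trans hs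
  have hs0 : 0 < s := (Fintype.card_pos_iff.2 ⟨C.out⟩).trans_le hV
  obtain ⟨ν, hν⟩ := C.exists_injective_vars
  have : Fintype C.vars := Fintype.ofInjective ν hν
  have hW : Fintype.card C.vars ≤ s := (Fintype.card_le_of_injective ν hν).trans hV
  choose e he g δ hδ hsum hprod using fun i : Fin L.length => hL (L.get i) (List.get_mem L i)
  have hword := fun i j => exists_eq_sum_words (fun w : C.vars => (w : σ)) (e := δ i j) (p := g i j)
    (by rw [← Set.image_eq_range]; exact (hδ i j).2)
  choose a ha using hword
  let D := fourLevel (fun w : C.vars => (w : σ)) (fun i => (L.get i).1)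
    (fun i j => (⟨δ i j, Nat.lt_succ_of_le (hδ i j).1⟩ : Fin (t + 1))) a
  refine ⟨D, ?_, fourLevel_isSigmaPiSigmaPi .., fourLevel_isHomogeneousBelowOutput ..,
    fun e₀ he₀ => fourLevel_isHomogeneous _ _ _ _ fun i => (hsum i).trans (he₀ _ (he i)),
    fourLevel_topFanIn .., fourLevel_size_le _ _ _ _ hW fun e' he' =>
      (Nat.pow_le_pow_left hW _).trans (Nat.pow_le_pow_right hs0 he')⟩
  have h : (L.map fun q => q.1 • q.2).sum = ∑ i : Fin L.length, (L.get i).1 • (L.get i).2 := by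
    rw [← List.sum_ofFn]
    congr 1
    conv_lhs => rw [← List.ofFn_get L, List.map_ofFn]
    rfl
  rw [h]
  simp only [hprod, ha]
  exact fourLevel_computes ..

theorem expansionBound_le {t j e d : ℕ} (he : e ≤ d) : expansionBound t j e ≤ 3 * d / t := by
  unfold expansionBound
  split_ifs
  · exact Nat.zero_le _
  · exact (Nat.sub_le _ _).trans (Nat.div_le_div_right (by omega))

theorem exists_sigmaPiSigmaPi_of_size_le {F : Type u} [Field F] {σ : Type} (C : Circuit F σ)
    {f : MvPolynomial σ F} {s d t : ℕ} (hd : f.totalDegree = d) (hf : C.Computes f)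
    (hs : C.size ≤ s) (ht : 0 < t) :
    ∃ (D : Circuit F σ) (A : ℕ), D.Computes f ∧ D.IsSigmaPiSigmaPi t ∧
      D.IsHomogeneousBelowOutput ∧ (f.IsHomogeneous d → D.IsHomogeneous) ∧ D.topFanIn ≤ A ∧
      A = (d + 1) * ((s * ((s + 1) * (d + 1))) ^ 3) ^ (3 * d / t) ∧
      D.size ≤ 1 + A + A * (2 * (3 * d / t) + 1) + (t + 1) * s ^ t + s +
        (A + A * (2 * (3 * d / t) + 1) + A * (2 * (3 * d / t) + 1) * s ^ t +
          (t + 1) * s ^ t * t) := by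
  classical
  have hs0 : 0 < s := (Fintype.card_pos_iff.2 ⟨C.out⟩).trans_le ((Nat.le_add_right _ _).trans hs)
  set M := (s * ((s + 1) * (d + 1))) ^ 3 with hMdef
  have hM : 1 ≤ M := Nat.one_le_pow _ _ (by positivity)
  have hcomp : ∀ e ≤ d, IsSumBoundedProd C.linearForms t (M ^ (3 * d / t)) (2 * (3 * d / t) + 1) e
      (MvPolynomial.homogeneousComponent e f) := fun e he => by
    have hq := expansionBound_le (t := t) (j := 2) he
    have := C.isSumBoundedProd_homogeneousComponent hs ht he
    rw [show C.eval C.out = f from hf] at this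
    exact this.mono (Nat.pow_le_pow_right hM hq) (by omega)
  -- The degrees to be summed: only `d` if `f` is homogeneous, so that the output gate respects
  -- degrees too, and `0, …, d` otherwise.
  obtain ⟨E, hE, hEd, hEf⟩ : ∃ E : List ℕ, E.length ≤ d + 1 ∧
      (∀ e ∈ E, e ≤ d ∧ (f.IsHomogeneous d → e = d)) ∧
      f = (E.map fun e => MvPolynomial.homogeneousComponent e f).sum := by
    by_cases h : f.IsHomogeneous d
    · refine ⟨[d], by simp, by simp, ?_⟩
      simpa using (MvPolynomial.homogeneousComponent_eq_self
        ((MvPolynomial.mem_homogeneousSubmodule _ _).2 h)).symm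
    · refine ⟨List.range (d + 1), by simp, fun e he => ⟨?_, fun h' => absurd h' h⟩, ?_⟩
      · exact Nat.lt_succ_iff.1 (List.mem_range.1 he)
      · conv_lhs => rw [← MvPolynomial.sum_homogeneousComponent f, hd]
        rw [← List.sum_toFinset _ List.nodup_range, List.toFinset_range]
  obtain ⟨L, hLlen, hL, hLf⟩ : ∃ L : List (F × MvPolynomial σ F),
      L.length ≤ E.length * M ^ (3 * d / t) ∧
      (∀ q ∈ L, ∃ e, (e ≤ d ∧ (f.IsHomogeneous d → e = d)) ∧
        IsBoundedProd C.linearForms t (2 * (3 * d / t) + 1) e q.2) ∧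
      (E.map fun e => MvPolynomial.homogeneousComponent e f).sum =
        (L.map fun q => q.1 • q.2).sum := by
    clear hE hEf
    induction E with
    | nil => exact ⟨[], by simp, by simp, by simp⟩
    | cons e E ih =>
      obtain ⟨L, h1, h2, h3⟩ := ih fun e he => hEd e (by simp [he])
      have he := hEd e (by simp)
      obtain ⟨L', h1', h2', h3'⟩ := hcomp e he.1
      refine ⟨L' ++ L, ?_, fun q hq => ?_, ?_⟩
      · rw [List.length_append, List.length_cons, add_mul, one_mul]
        omega
      · rcases List.mem_append.1 hq with h | h
        · exact ⟨e, he, h2' q h⟩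
        · exact h2 q h
      · rw [List.map_append, List.sum_append, List.map_cons, List.sum_cons, h3, h3']
  obtain ⟨D, h1, h2, h3, h4, h5, h6⟩ := C.exists_sigmaPiSigmaPi hs L _ hL
  have hA : L.length ≤ (d + 1) * M ^ (3 * d / t) := hLlen.trans (Nat.mul_le_mul_right _ hE)
  refine ⟨D, _, ?_, h2, h3, fun h => h4 d fun e' he' => he'.2 h, h5 ▸ hA, rfl, h6.trans (by gcongr)⟩
  rw [hEf, hLf]
  exact h1

end Circuit

/-! ### Numerical estimates and the theorem. -/

theorem topFanIn_bound {k s d q : ℕ} (hs : 2 ≤ s) (hd : d ≤ s ^ k) :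
    (d + 1) * ((s * ((s + 1) * (d + 1))) ^ 3) ^ q ≤ s ^ (k + 1 + 3 * (k + 4) * q) := by
  have hd1 : d + 1 ≤ s ^ (k + 1) := by
    have : 1 ≤ s ^ k := Nat.one_le_pow _ _ (by omega)
    rw [pow_succ]
    nlinarith
  have hs1 : s + 1 ≤ s ^ 2 := by nlinarith
  have h : s * ((s + 1) * (d + 1)) ≤ s ^ (k + 4) :=
    calc s * ((s + 1) * (d + 1)) ≤ s * (s ^ 2 * s ^ (k + 1)) := by gcongr
      _ = s ^ (k + 4) := by ring
  calc (d + 1) * ((s * ((s + 1) * (d + 1))) ^ 3) ^ q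
      ≤ s ^ (k + 1) * ((s ^ (k + 4)) ^ 3) ^ q := by gcongr
    _ = s ^ (k + 1 + 3 * (k + 4) * q) := by rw [← pow_mul, ← pow_mul, ← pow_add]; ring_nf

theorem size_bound {k s d t A a : ℕ} (hs : 2 ≤ s) (hd : d ≤ s ^ k) (htd : t ≤ d)
    (hA : A ≤ s ^ a) :
    1 + A + A * (2 * (3 * d / t) + 1) + (t + 1) * s ^ t + s +
        (A + A * (2 * (3 * d / t) + 1) + A * (2 * (3 * d / t) + 1) * s ^ t +
          (t + 1) * s ^ t * t) ≤ s ^ (a + 3 * k + 10 + t) := by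
  have hs0 : 0 < s := by omega
  have hk : 1 ≤ s ^ k := Nat.one_le_pow _ _ hs0
  have h8 : ∀ {x}, x ≤ 8 * s ^ k → x ≤ s ^ (k + 3) := fun {x} h => by
    have : 2 ^ 3 ≤ s ^ 3 := Nat.pow_le_pow_left hs 3
    rw [pow_add, mul_comm]
    exact h.trans (Nat.mul_le_mul_right _ this)
  have hK : 2 * (3 * d / t) + 1 ≤ s ^ (k + 3) := h8 (by
    have := Nat.div_le_self (3 * d) t
    omega)
  have ht : t ≤ s ^ (k + 3) := h8 (by omega)
  have ht1 : t + 1 ≤ s ^ (k + 3) := h8 (by omega)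
  have mono : ∀ {x b}, x ≤ s ^ b → b ≤ a + 3 * k + 6 + t → x ≤ s ^ (a + 3 * k + 6 + t) :=
    fun h hb => h.trans (Nat.pow_le_pow_right hs0 hb)
  have mul : ∀ {x y b c}, x ≤ s ^ b → y ≤ s ^ c → x * y ≤ s ^ (b + c) := fun h h' => by
    rw [pow_add]; exact Nat.mul_le_mul h h'
  have e1 := mono (x := 1) (b := 0) (by simp) (by omega)
  have e2 := mono hA (by omega)
  have e3 := mono (mul hA hK) (by omega)
  have e4 := mono (mul ht1 le_rfl : (t + 1) * s ^ t ≤ _) (by omega)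
  have e5 := mono (x := s) (b := 1) (by simp) (by omega)
  have e6 := mono (mul (mul hA hK) (le_refl (s ^ t))) (by omega)
  have e7 := mono (mul (mul ht1 (le_refl (s ^ t))) ht) (by omega)
  -- There are nine summands, each at most the common power, and `9 ≤ 16 ≤ s ^ 4`.
  have h16 : 2 ^ 4 ≤ s ^ 4 := Nat.pow_le_pow_left hs 4
  calc _ ≤ 2 ^ 4 * s ^ (a + 3 * k + 6 + t) := by omega
    _ ≤ s ^ 4 * s ^ (a + 3 * k + 6 + t) := Nat.mul_le_mul_right _ h16
    _ = s ^ (a + 3 * k + 10 + t) := by rw [← pow_add]; congr 1; omega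

theorem natCast_le_rpow {x s e : ℕ} {y : ℝ} (hs : 2 ≤ s) (h : x ≤ s ^ e) (he : (e : ℝ) ≤ y) :
    (x : ℝ) ≤ (s : ℝ) ^ y :=
  calc (x : ℝ) ≤ (s : ℝ) ^ e := by exact_mod_cast h
    _ = (s : ℝ) ^ (e : ℝ) := (Real.rpow_natCast _ _).symm
    _ ≤ (s : ℝ) ^ y := Real.rpow_le_rpow_of_exponent_le (by exact_mod_cast (by omega : 1 ≤ s)) he

theorem mainTheorem1 : ∀ k : ℕ, ∃ c : ℕ, ∀ (F : Type u) [Field F] (n d s t : ℕ)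
    (f : MvPolynomial (Fin n) F), f.totalDegree = d →
    ∀ C : Circuit F (Fin n), C.Computes f → C.size ≤ s → 2 ≤ s → d ≤ s ^ k → 0 < t → t ≤ d →
    ∃ D : Circuit F (Fin n),
      D.Computes f ∧
      D.IsSigmaPiSigmaPi t ∧
      D.IsHomogeneousBelowOutput ∧
      (f.IsHomogeneous d → D.IsHomogeneous) ∧
      (D.topFanIn : ℝ) ≤ (s : ℝ) ^ ((c : ℝ) * ((d : ℝ) / (t : ℝ))) ∧
      (D.size : ℝ) ≤ (s : ℝ) ^ ((c : ℝ) * ((t : ℝ) + (d : ℝ) / (t : ℝ))) := by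
  intro k
  -- As `d / t ≥ 1`, the top fan-in exponent is at most `(k + 1) + 9 * (k + 4) = 10 * k + 37` times
  -- `d / t`; the size adds `3 * k + 10` to this coefficient, and a further `t` to the exponent.
  refine ⟨13 * k + 47, fun F _ n d s t f hd C hf hsize hs hdk ht htd => ?_⟩
  obtain ⟨D, A, h1, h2, h3, h4, h5, hA, h6⟩ :=
    C.exists_sigmaPiSigmaPi_of_size_le hd hf hsize ht
  have hAs : A ≤ s ^ (k + 1 + 3 * (k + 4) * (3 * d / t)) := hA ▸ topFanIn_bound hs hdk
  have hq : ((3 * d / t : ℕ) : ℝ) ≤ 3 * ((d : ℝ) / t) := by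
    refine Nat.cast_div_le.trans_eq ?_
    push_cast
    ring
  have hy : 1 ≤ (d : ℝ) / t := (one_le_div (by exact_mod_cast ht)).2 (by exact_mod_cast htd)
  have ha : ((k + 1 + 3 * (k + 4) * (3 * d / t) : ℕ) : ℝ) ≤ (10 * k + 37) * ((d : ℝ) / t) := by
    push_cast at hq ⊢
    have h := mul_le_mul_of_nonneg_left hq (by positivity : (0 : ℝ) ≤ 3 * (k + 4))
    have h' := mul_le_mul_of_nonneg_left hy (by positivity : (0 : ℝ) ≤ k + 1)
    linarith
  have hk : (0 : ℝ) ≤ k := Nat.cast_nonneg k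
  refine ⟨D, h1, h2, h3, h4, natCast_le_rpow hs (h5.trans hAs) (ha.trans ?_),
    natCast_le_rpow hs (h6.trans (size_bound hs hdk htd hAs)) ?_⟩
  · push_cast
    gcongr <;> linarith
  · have h := mul_le_mul_of_nonneg_left hy (by positivity : (0 : ℝ) ≤ 3 * k + 10)
    have h' : (t : ℝ) ≤ (13 * k + 47) * t :=
      le_mul_of_one_le_left (Nat.cast_nonneg t) (by linarith)
    rw [Nat.cast_add, Nat.cast_add, Nat.cast_add]
    push_cast at ha ⊢
    linarith
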